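/- Let $\mathbb{S}^1=\mathbb{R}/\mathbb{Z}$ with projection $e:\mathbb{R}\to\mathbb{S}^1$, and let $f:\mathbb{S}^1\to\mathbb{S}^1$ be a continuous map that has a continuous non-decreasing lifting $F:\mathbb{R}\to\mathbb{R}$ (so $f\circ e=e\circ F$) with $F(x+1)=F(x)+1$ for all $x$. Assume that the rotation number $\rho=\lim_{n\to\infty}\frac{F^n(x)-x}{n}$ (which exists and does not depend on $x$) is irrational, and let $R_\rho(\theta)=\theta+\rho \pmod 1$. A *Denjoy semiconjugacy* is a continuous map $h:\mathbb{S}^1\to\mathbb{S}^1$ that has a continuous non-decreasing lifting $H$ with $H(x+1)=H(x)+1$ for all $x$, and satisfies $h\circ f=R_\rho\circ h$. Let $\mathrm{Con}(f)$ be the set of points of $\mathbb{S}^1$ having a neighbourhood on which $f$ is constant. Then a Denjoy semiconjugacy exists, $f$ has a unique ergodic (Borel probability, $f$-invariant) measure $\mu$, and there is a measurable set $\mathscr{U}\subset\mathbb{S}^1$ with $f(\mathscr{U})=\mathscr{U}$ such that 1. $\mu(\mathscr{U})=1$; 2. the closure of $\mathscr{U}$ is disjoint from $\mathrm{Con}(f)$;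 3. for every Denjoy semiconjugacy $h$, the restriction $h|_{\mathscr{U}}:\mathscr{U}\to h(\mathscr{U})$ is a homeomorphism, $h(\mathscr{U})$ is dense in $\mathbb{S}^1$, and $R_\rho(h(\mathscr{U}))=h(\mathscr{U})$; 4. if $f$ is not a homeomorphism, then $\mathscr{U}$ is nowhere dense in $\mathbb{S}^1$. -/

import Mathlib

/-- `F` is a lifting of the circle map `f`, i.e. `f ∘ e = e ∘ F` for the projection `e : ℝ → ℝ/ℤ`. -/
def IsCircleLift (F : ℝ → ℝ) (f : UnitAddCircle → UnitAddCircle) : Prop :=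
  ∀ x : ℝ, f (x : UnitAddCircle) = ((F x : ℝ) : UnitAddCircle)

/-- The rotation `θ ↦ θ + ρ (mod 1)`. -/
def circleRotation (ρ : ℝ) (θ : UnitAddCircle) : UnitAddCircle :=
  θ + (ρ : UnitAddCircle)

/-- `Con(f)`: the points having a neighbourhood on which `f` is constant. -/
def locallyConstantSet (f : UnitAddCircle → UnitAddCircle) : Set UnitAddCircle :=
  {θ | ∃ V ∈ nhds θ, ∃ c : UnitAddCircle, ∀ x ∈ V, f x = c}

/-- `h` is a continuous non-decreasing circle map of degree one (that is, it has a continuous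
non-decreasing lifting `H` with `H (x + 1) = H x + 1`) such that `h ∘ f = R_ρ ∘ h`. -/
structure IsDenjoySemiconj (f : UnitAddCircle → UnitAddCircle) (ρ : ℝ)
    (h : UnitAddCircle → UnitAddCircle) : Prop where
  continuous : Continuous h
  exists_lift : ∃ H : CircleDeg1Lift, Continuous H ∧ IsCircleLift H h
  semiconj : Function.Semiconj h f (circleRotation ρ)

open Function Set Filter Topology MeasureTheory

/-! For irrational `ρ` the points `F^n 0 + m` are ordered on the line as the numbers `n ρ + m`.
These are dense, so the order-preserving correspondence extends to a monotone map without jumps that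
semiconjugates `F` to translation by `ρ`; density also makes it unique up to a constant. A monotone
`h` has only countably many values with several preimages. Discarding their full `ρ`-orbits leaves a
co-countable rotation-invariant set `T`, and `U = h⁻¹(T)`, on which `h` is injective. Every
invariant probability pushes forward under `h` to Lebesgue measure, by unique ergodicity of the
rotation. As `T` has full measure, this determines the measure on `U`. A point of `U` in `Con(f)`
would have a neighbourhood collapsed by `h`. If `f` is not injective, `Con(f)` is nonempty, and
pulling it back along orbits shows that `U` is dense in no open set. -/

theorem UnitAddCircle.coe_eq_coe_iff {x y : ℝ} :
    (x : UnitAddCircle) = y ↔ ∃ k : ℤ, y = x + k := by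
  rw [QuotientAddGroup.eq, AddSubgroup.mem_zmultiples_iff]
  refine exists_congr fun k => ?_
  rw [zsmul_one]
  constructor <;> intro h <;> linarith

theorem denseRange_nsmul_coe_of_irrational {ρ : ℝ} (hρ : Irrational ρ) :
    DenseRange fun n : ℕ => n • (ρ : UnitAddCircle) := by
  rw [← denseRange_zsmul_iff_nsmul, AddCircle.denseRange_zsmul_coe_iff]
  simpa using hρ

/-- The numbers `n ρ + m` with `n : ℕ`, `m : ℤ` are dense in `ℝ` for irrational `ρ`. -/
theorem Irrational.exists_nat_mul_add_int_mem_Ioo {ρ : ℝ} (hρ : Irrational ρ) {a b : ℝ}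
    (hab : a < b) : ∃ (n : ℕ) (m : ℤ), a < n * ρ + m ∧ n * ρ + m < b := by
  have hopen : IsOpen ((fun x : ℝ => (x : UnitAddCircle)) '' Ioo a b) :=
    QuotientAddGroup.isOpenMap_coe _ isOpen_Ioo
  obtain ⟨n, t, ht, hn⟩ := (denseRange_nsmul_coe_of_irrational hρ).exists_mem_open hopen
    ((nonempty_Ioo.2 hab).image _)
  have hn' : ((n * ρ : ℝ) : UnitAddCircle) = (t : UnitAddCircle) := by
    rw [← nsmul_eq_mul]; exact hn.symm
  obtain ⟨m, hm⟩ := UnitAddCircle.coe_eq_coe_iff.1 hn'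
  refine ⟨n, m, ?_⟩
  rw [← hm]
  exact ht

/-! ### The semiconjugacy on the line: existence and uniqueness -/

namespace CircleDeg1Lift

variable {F : CircleDeg1Lift}

/-- The points `F^n x + m` are ordered like the values
`n τ + m` as long as the latter are distinct. -/
theorem iterate_add_int_lt_of_lt (x : ℝ) {n n' : ℕ}
    {m m' : ℤ} (h : n * F.translationNumber + m < n' * F.translationNumber + m') :
    F^[n] x + m < F^[n'] x + m' := by
  rcases le_total n n' with hn | hn
  · obtain ⟨k, rfl⟩ := Nat.exists_eq_add_of_le hn
    have hk : ((m - m' : ℤ) : ℝ) < (F ^ k).translationNumber := by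
      rw [translationNumber_pow]; push_cast at h ⊢; linarith
    have := lt_map_of_int_lt_translationNumber (F ^ k) hk (F^[n] x)
    rw [coe_pow, ← iterate_add_apply, add_comm k] at this
    push_cast at this
    linarith
  · obtain ⟨k, rfl⟩ := Nat.exists_eq_add_of_le hn
    have hk : (F ^ k).translationNumber < ((m' - m : ℤ) : ℝ) := by
      rw [translationNumber_pow]; push_cast at h ⊢; linarith
    have := map_lt_of_translationNumber_lt_int (F ^ k) hk (F^[n'] x)
    rw [coe_pow, ← iterate_add_apply, add_comm k] at this
    push_cast at this
    linarith

/-- The values `n τ + m` of the orbit points `F^n 0 + m` that lie to the left of `y`. -/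
def orbitValuesBelow (F : CircleDeg1Lift) (y : ℝ) : Set ℝ :=
  {a | ∃ (n : ℕ) (m : ℤ), a = n * F.translationNumber + m ∧ F^[n] 0 + m ≤ y}

theorem orbitValuesBelow_nonempty (F : CircleDeg1Lift) (y : ℝ) : (F.orbitValuesBelow y).Nonempty :=
  ⟨_, 0, ⌊y⌋, rfl, by simpa using Int.floor_le y⟩

theorem bddAbove_orbitValuesBelow (y : ℝ) :
    BddAbove (F.orbitValuesBelow y) := by
  refine ⟨(⌊y⌋ + 1 : ℤ), ?_⟩
  rintro _ ⟨n, m, rfl, h⟩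
  by_contra! hlt
  have := iterate_add_int_lt_of_lt 0 (n := 0) (m := ⌊y⌋ + 1) (n' := n) (m' := m)
    (by simpa using hlt)
  have h2 := Int.lt_floor_add_one y
  push_cast [iterate_zero, id] at this
  linarith

theorem le_sSup_orbitValuesBelow {y : ℝ} {n : ℕ} {m : ℤ}
    (h : F^[n] 0 + m ≤ y) :
    n * F.translationNumber + m ≤ sSup (F.orbitValuesBelow y) :=
  le_csSup (bddAbove_orbitValuesBelow y) ⟨n, m, rfl, h⟩

theorem sSup_orbitValuesBelow_le {y : ℝ} {n : ℕ} {m : ℤ}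
    (h : y ≤ F^[n] 0 + m) :
    sSup (F.orbitValuesBelow y) ≤ n * F.translationNumber + m := by
  refine csSup_le (F.orbitValuesBelow_nonempty y) ?_
  rintro _ ⟨n', m', rfl, h'⟩
  by_contra! hlt
  have := iterate_add_int_lt_of_lt 0 hlt
  linarith

/-- The monotone degree one map sending `F^n 0 + m` to `n τ + m`. -/
noncomputable def denjoyLift (F : CircleDeg1Lift) :
    CircleDeg1Lift where
  toFun y := sSup (F.orbitValuesBelow y)
  monotone' x y hxy := by
    refine csSup_le_csSup (bddAbove_orbitValuesBelow y) (F.orbitValuesBelow_nonempty x) ?_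
    rintro _ ⟨n, m, rfl, h⟩
    exact ⟨n, m, rfl, h.trans hxy⟩
  map_add_one' y := by
    apply le_antisymm
    · refine csSup_le (F.orbitValuesBelow_nonempty _) ?_
      rintro _ ⟨n, m, rfl, h⟩
      have := le_sSup_orbitValuesBelow (y := y) (n := n) (m := m - 1) (by push_cast; linarith)
      push_cast at this
      linarith
    · rw [← le_sub_iff_add_le]
      refine csSup_le (F.orbitValuesBelow_nonempty _) ?_
      rintro _ ⟨n, m, rfl, h⟩
      have := le_sSup_orbitValuesBelow (y := y + 1) (n := n) (m := m + 1)
        (by push_cast; linarith)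
      push_cast at this
      linarith

theorem denjoyLift_le {y : ℝ} {n : ℕ} {m : ℤ}
    (h : y ≤ F^[n] 0 + m) : F.denjoyLift y ≤ n * F.translationNumber + m :=
  sSup_orbitValuesBelow_le h

theorem le_denjoyLift {y : ℝ} {n : ℕ} {m : ℤ}
    (h : F^[n] 0 + m ≤ y) : n * F.translationNumber + m ≤ F.denjoyLift y :=
  le_sSup_orbitValuesBelow h

theorem continuous_denjoyLift (hρ : Irrational F.translationNumber) :
    Continuous F.denjoyLift := by
  -- A monotone map with dense range cannot jump; the range contains all `n τ + m`.
  refine F.denjoyLift.monotone.continuous_of_denseRange ?_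
  refine dense_of_exists_between fun a b hab => ?_
  obtain ⟨n, m, h1, h2⟩ := hρ.exists_nat_mul_add_int_mem_Ioo hab
  refine ⟨_, ⟨F^[n] 0 + m, rfl⟩, ?_⟩
  rw [le_antisymm (denjoyLift_le le_rfl) (le_denjoyLift le_rfl)]
  exact ⟨h1, h2⟩

theorem denjoyLift_apply (hρ : Irrational F.translationNumber) (x : ℝ) :
    F.denjoyLift (F x) = F.denjoyLift x + F.translationNumber := by
  have key (n : ℕ) (m : ℤ) : F (F^[n] 0 + m) = F^[n + 1] 0 + m := by
    rw [map_add_int, iterate_succ_apply']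
  apply le_antisymm
  · by_contra! hlt
    -- The value `n τ + m` in the gap puts its orbit point to the right of `x`; applying `F` raises
    -- that value by `τ` and bounds `F.denjoyLift (F x)` too tightly.
    obtain ⟨n, m, h1, h2⟩ := hρ.exists_nat_mul_add_int_mem_Ioo (lt_sub_iff_add_lt.2 hlt)
    have hx : x ≤ F^[n] 0 + m := by
      by_contra! h
      exact (le_denjoyLift h.le).not_gt h1
    have := denjoyLift_le ((F.monotone hx).trans_eq (key n m))
    push_cast at this
    linarith
  · by_contra! hlt
    obtain ⟨n, m, h1, h2⟩ := hρ.exists_nat_mul_add_int_mem_Ioo (sub_lt_iff_lt_add.2 hlt)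
    have hx : F^[n] 0 + m ≤ x := by
      by_contra! h
      exact (denjoyLift_le h.le).not_gt h2
    have := le_denjoyLift ((key n m).symm.trans_le (F.monotone hx))
    push_cast at this
    linarith

theorem apply_iterate_add_int_of_semiconj {H : CircleDeg1Lift} {ρ : ℝ}
    (hH : ∀ x, H (F x) = H x + ρ) (n : ℕ) (m : ℤ) (x : ℝ) :
    H (F^[n] x + m) = H x + (n * ρ + m) := by
  rw [map_add_int]
  induction n with
  | zero => simp
  | succ n ih =>
    rw [iterate_succ_apply', hH]
    push_cast
    linarith

/-- A value `n ρ + m` strictly between the two sides would place `F^n 0 + m` left of `y` according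
to `H₂`, but right of it according to `H₁`. -/
theorem sub_apply_zero_le_of_semiconj {H₁ H₂ : CircleDeg1Lift} {ρ : ℝ} (hρ : Irrational ρ)
    (h₁ : ∀ x, H₁ (F x) = H₁ x + ρ) (h₂ : ∀ x, H₂ (F x) = H₂ x + ρ) (y : ℝ) :
    H₂ y - H₂ 0 ≤ H₁ y - H₁ 0 := by
  by_contra! hlt
  obtain ⟨n, m, ha, hb⟩ := hρ.exists_nat_mul_add_int_mem_Ioo hlt
  have e₁ := apply_iterate_add_int_of_semiconj h₁ n m 0
  have e₂ := apply_iterate_add_int_of_semiconj h₂ n m 0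
  have hy : F^[n] 0 + m < y := H₂.monotone.reflect_lt (by linarith)
  have := H₁.monotone hy.le
  linarith

/-- A semiconjugacy to an irrational translation is unique up to an additive constant. -/
theorem sub_apply_zero_eq_of_semiconj {H₁ H₂ : CircleDeg1Lift} {ρ : ℝ} (hρ : Irrational ρ)
    (h₁ : ∀ x, H₁ (F x) = H₁ x + ρ) (h₂ : ∀ x, H₂ (F x) = H₂ x + ρ) (y : ℝ) :
    H₂ y - H₂ 0 = H₁ y - H₁ 0 :=
  le_antisymm (sub_apply_zero_le_of_semiconj hρ h₁ h₂ y) (sub_apply_zero_le_of_semiconj hρ h₂ h₁ y)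

end CircleDeg1Lift

/-! ### Passage to the circle -/

theorem CircleDeg1Lift.exists_isCircleLift (H : CircleDeg1Lift) (hH : Continuous H) :
    ∃ h : UnitAddCircle → UnitAddCircle, Continuous h ∧ IsCircleLift H h := by
  have hper : Periodic (fun x => (H x : UnitAddCircle)) 1 := fun x => by simp
  refine ⟨hper.lift, ?_, fun x => hper.lift_coe x⟩
  exact continuous_coinduced_dom.2 ((AddCircle.continuous_mk' 1).comp hH)

theorem exists_isDenjoySemiconj {f : UnitAddCircle → UnitAddCircle} {F : CircleDeg1Lift}
    (hF : IsCircleLift F f) (hρ : Irrational F.translationNumber) :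
    ∃ h, IsDenjoySemiconj f F.translationNumber h := by
  obtain ⟨h, hc, hl⟩ := F.denjoyLift.exists_isCircleLift (F.continuous_denjoyLift hρ)
  refine ⟨h, hc, ⟨_, F.continuous_denjoyLift hρ, hl⟩, fun θ => ?_⟩
  induction θ using QuotientAddGroup.induction_on with
  | H x =>
    rw [hF, hl, hl, CircleDeg1Lift.denjoyLift_apply hρ, circleRotation, AddCircle.coe_add]

/-- The lifted equation holds up to an integer, constant by connectedness; semiconjugacy preserves
translation numbers, so that integer is zero. -/
theorem IsCircleLift.semiconj_add {f h : UnitAddCircle → UnitAddCircle} {F H : CircleDeg1Lift}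
    (hF : IsCircleLift F f) (hFc : Continuous F) (hH : IsCircleLift H h) (hHc : Continuous H)
    (hs : Semiconj h f (circleRotation F.translationNumber)) (x : ℝ) :
    H (F x) = H x + F.translationNumber := by
  have hint (x : ℝ) : ∃ k : ℤ, H (F x) = H x + F.translationNumber + k := by
    rw [← UnitAddCircle.coe_eq_coe_iff, ← hH, ← hF, hs, hH, circleRotation, AddCircle.coe_add]
  obtain ⟨k, hk⟩ : ∃ k : ℤ, ∀ x, H (F x) = H x + F.translationNumber + k := by
    obtain ⟨k, hk⟩ := hint 0
    have hmaps : MapsTo (fun x => H (F x) - H x - F.translationNumber) univ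
        (range ((↑) : ℤ → ℝ)) := fun x _ => by
      obtain ⟨k, hk⟩ := hint x
      exact ⟨k, by simp only [hk]; ring⟩
    have hdisc : IsDiscrete (range ((↑) : ℤ → ℝ)) :=
      Int.isClosedEmbedding_coe_real.isInducing.isDiscrete_range
    refine ⟨k, fun x => ?_⟩
    have := isPreconnected_univ.constant_of_mapsTo (S := univ) (T := range ((↑) : ℤ → ℝ)) hdisc
      (by fun_prop) hmaps (mem_univ x) (mem_univ 0)
    simp only [hk] at this
    linarith
  have hτ := CircleDeg1Lift.translationNumber_eq_of_semiconj (f := H) (g₁ := F)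
    (g₂ := CircleDeg1Lift.translate (Multiplicative.ofAdd (F.translationNumber + k))) fun x => by
      rw [hk, CircleDeg1Lift.translate_apply]; ring
  rw [CircleDeg1Lift.translationNumber_translate] at hτ
  rw [hk]
  linarith

/-- Denjoy semiconjugacies are unique up to a rotation. -/
theorem IsDenjoySemiconj.exists_eq_add {f h₁ h₂ : UnitAddCircle → UnitAddCircle}
    {F : CircleDeg1Lift} (hF : IsCircleLift F f) (hFc : Continuous F)
    (hρ : Irrational F.translationNumber) (hh₁ : IsDenjoySemiconj f F.translationNumber h₁)
    (hh₂ : IsDenjoySemiconj f F.translationNumber h₂) : ∃ c, ∀ θ, h₂ θ = h₁ θ + c := by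
  obtain ⟨H₁, hc₁, hl₁⟩ := hh₁.exists_lift
  obtain ⟨H₂, hc₂, hl₂⟩ := hh₂.exists_lift
  refine ⟨((H₂ 0 - H₁ 0 : ℝ) : UnitAddCircle), fun θ => ?_⟩
  induction θ using QuotientAddGroup.induction_on with
  | H x =>
    have := CircleDeg1Lift.sub_apply_zero_eq_of_semiconj hρ
      (hF.semiconj_add hFc hl₁ hc₁ hh₁.semiconj) (hF.semiconj_add hFc hl₂ hc₂ hh₂.semiconj) x
    rw [hl₁, hl₂, ← AddCircle.coe_add]
    congr 1
    linarith

instance UnitAddCircle.instNontrivial : Nontrivial UnitAddCircle := by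
  refine ⟨((0 : ℝ) : UnitAddCircle), ((1 / 2 : ℝ) : UnitAddCircle), fun h => ?_⟩
  obtain ⟨k, hk⟩ := UnitAddCircle.coe_eq_coe_iff.1 h
  have : (1 : ℤ) = 2 * k := by
    have : (1 : ℝ) = 2 * k := by linarith
    exact_mod_cast this
  omega

instance UnitAddCircle.instNullSingletonClass : NullSingletonClass (volume : Measure UnitAddCircle) :=
  have : (𝓝[≠] (0 : UnitAddCircle)).NeBot := inferInstance
  inferInstance

/-! ### Fibres and plateaus of monotone circle maps -/

section Lifts

variable {g : UnitAddCircle → UnitAddCircle} {G : CircleDeg1Lift}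

theorem IsCircleLift.surjective (hG : IsCircleLift G g) (hGc : Continuous G) : Surjective g := by
  intro θ
  induction θ using QuotientAddGroup.induction_on with
  | H y =>
    obtain ⟨x, rfl⟩ := G.continuous_iff_surjective.1 hGc y
    exact ⟨x, hG x⟩

theorem IsCircleLift.exists_lt_of_apply_eq (hG : IsCircleLift G g) {θ η : UnitAddCircle}
    (hne : θ ≠ η) (h : g θ = g η) :
    ∃ x y : ℝ, x < y ∧ G x = G y ∧ g θ = (G x : UnitAddCircle) := by
  induction θ using QuotientAddGroup.induction_on with | H x => ?_
  induction η using QuotientAddGroup.induction_on with | H y => ?_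
  rw [hG, hG, eq_comm, UnitAddCircle.coe_eq_coe_iff] at h
  obtain ⟨k, hk⟩ := h
  rw [← G.map_add_int] at hk
  have hxy : x ≠ y + k := fun e => hne (UnitAddCircle.coe_eq_coe_iff.2 ⟨k, e⟩).symm
  rcases hxy.lt_or_gt with h | h
  · exact ⟨x, y + k, h, hk, hG x⟩
  · exact ⟨y + k, x, h, hk.symm, by rw [hG, hk]⟩

theorem IsCircleLift.countable_setOf_two_preimages (hG : IsCircleLift G g) :
    {t | ∃ θ η, θ ≠ η ∧ g θ = t ∧ g η = t}.Countable := by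
  refine (G.monotone.countable_setOfPred_two_preimages.image
    ((↑) : ℝ → UnitAddCircle)).mono ?_
  rintro t ⟨θ, η, hne, rfl, h⟩
  obtain ⟨x, y, hlt, he, hx⟩ := hG.exists_lt_of_apply_eq hne h.symm
  exact ⟨G x, ⟨x, y, hlt, rfl, he.symm⟩, hx.symm⟩

theorem IsCircleLift.nonempty_locallyConstantSet (hG : IsCircleLift G g) (hg : ¬ Injective g) :
    (locallyConstantSet g).Nonempty := by
  simp only [Injective, not_forall] at hg
  obtain ⟨θ, η, h, hne⟩ := hg
  obtain ⟨x, y, hlt, he, -⟩ := hG.exists_lt_of_apply_eq hne h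
  obtain ⟨z, hz⟩ := exists_between hlt
  refine ⟨z, ((↑) : ℝ → UnitAddCircle) '' Ioo x y, ?_, G x, ?_⟩
  · exact (QuotientAddGroup.isOpenMap_coe _ isOpen_Ioo).mem_nhds ⟨z, hz, rfl⟩
  · rintro _ ⟨w, hw, rfl⟩
    rw [hG]
    congr 1
    exact le_antisymm ((G.monotone hw.2.le).trans_eq he.symm) (G.monotone hw.1.le)

end Lifts

theorem isOpen_locallyConstantSet (f : UnitAddCircle → UnitAddCircle) :
    IsOpen (locallyConstantSet f) := by
  rw [isOpen_iff_mem_nhds]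
  rintro θ ⟨V, hV, c, hc⟩
  filter_upwards [eventually_mem_nhds_iff.2 hV] with η hη
  exact ⟨V, hη, c, hc⟩

/-- The points all of whose translates by multiples of `ρ` have at most one preimage under `h`. -/
def injectiveOrbitValues (ρ : ℝ) (h : UnitAddCircle → UnitAddCircle) : Set UnitAddCircle :=
  {t | ∀ n : ℤ, ∀ y z, h y = t + n • (ρ : UnitAddCircle) → h z = t + n • (ρ : UnitAddCircle) →
    y = z}

/-! ### The invariant set of values with singleton fibres -/

section InjectiveOrbitValues

variable {ρ : ℝ} {f h : UnitAddCircle → UnitAddCircle}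

theorem add_mem_injectiveOrbitValues {t : UnitAddCircle} (k : ℤ)
    (ht : t ∈ injectiveOrbitValues ρ h) :
    t + k • (ρ : UnitAddCircle) ∈ injectiveOrbitValues ρ h := by
  intro n y z hy hz
  rw [add_assoc, ← add_smul] at hy hz
  exact ht _ y z hy hz

theorem add_mem_injectiveOrbitValues_iff {t : UnitAddCircle} :
    t + (ρ : UnitAddCircle) ∈ injectiveOrbitValues ρ h ↔ t ∈ injectiveOrbitValues ρ h := by
  constructor <;> intro ht
  · simpa using add_mem_injectiveOrbitValues (-1) ht
  · simpa using add_mem_injectiveOrbitValues 1 ht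

theorem eq_of_mem_injectiveOrbitValues {x y : UnitAddCircle}
    (hx : h x ∈ injectiveOrbitValues ρ h) (hy : h y = h x) : y = x :=
  hx 0 y x (by simpa using hy) (by simp)

theorem countable_compl_injectiveOrbitValues {H : CircleDeg1Lift} (hH : IsCircleLift H h) :
    (injectiveOrbitValues ρ h)ᶜ.Countable := by
  have : (injectiveOrbitValues ρ h)ᶜ ⊆
      ⋃ n : ℤ, (· + n • (ρ : UnitAddCircle)) ⁻¹' {t | ∃ θ η, θ ≠ η ∧ h θ = t ∧ h η = t} := by
    intro t ht
    simp only [injectiveOrbitValues, mem_compl_iff, mem_ofPred_eq, not_forall] at ht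
    obtain ⟨n, y, z, hy, hz, hne⟩ := ht
    exact mem_iUnion.2 ⟨n, y, z, hne, hy, hz⟩
  exact (countable_iUnion fun n =>
    hH.countable_setOf_two_preimages.preimage (add_left_injective _)).mono this

/-- Since semiconjugacies differ by rotations, one set `U` serves them all. -/
theorem preimage_injectiveOrbitValues_congr {h' : UnitAddCircle → UnitAddCircle}
    {c : UnitAddCircle} (hc : ∀ θ, h' θ = h θ + c) :
    h' ⁻¹' injectiveOrbitValues ρ h' = h ⁻¹' injectiveOrbitValues ρ h := by
  ext x
  simp only [injectiveOrbitValues, mem_preimage, mem_ofPred_eq, hc, add_right_comm _ c,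
    add_left_inj]

end InjectiveOrbitValues

/-! ### Topological properties of `U` -/

namespace IsDenjoySemiconj

variable {ρ : ℝ} {f h : UnitAddCircle → UnitAddCircle}

theorem apply_map (hh : IsDenjoySemiconj f ρ h) (x : UnitAddCircle) : h (f x) = h x + ρ :=
  hh.semiconj x

theorem apply_iterate (hh : IsDenjoySemiconj f ρ h) (n : ℕ) (x : UnitAddCircle) :
    h (f^[n] x) = h x + n • (ρ : UnitAddCircle) := by
  induction n with
  | zero => simp
  | succ n ih => rw [iterate_succ_apply', hh.apply_map, ih, succ_nsmul, add_assoc]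

theorem surjective (hh : IsDenjoySemiconj f ρ h) : Surjective h := by
  obtain ⟨H, hHc, hH⟩ := hh.exists_lift
  exact hH.surjective hHc

theorem measurableSet_injectiveOrbitValues (hh : IsDenjoySemiconj f ρ h) :
    MeasurableSet (injectiveOrbitValues ρ h) := by
  obtain ⟨H, -, hH⟩ := hh.exists_lift
  exact (countable_compl_injectiveOrbitValues hH).measurableSet.of_compl

theorem volume_compl_injectiveOrbitValues (hh : IsDenjoySemiconj f ρ h) :
    volume (injectiveOrbitValues ρ h)ᶜ = 0 := by
  obtain ⟨H, -, hH⟩ := hh.exists_lift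
  exact (countable_compl_injectiveOrbitValues hH).measure_zero _

theorem measurableSet_preimage (hh : IsDenjoySemiconj f ρ h) :
    MeasurableSet (h ⁻¹' injectiveOrbitValues ρ h) :=
  hh.continuous.measurable hh.measurableSet_injectiveOrbitValues

theorem map_mem_iff (hh : IsDenjoySemiconj f ρ h) {x : UnitAddCircle} :
    f x ∈ h ⁻¹' injectiveOrbitValues ρ h ↔ x ∈ h ⁻¹' injectiveOrbitValues ρ h := by
  simp only [mem_preimage, hh.apply_map, add_mem_injectiveOrbitValues_iff]

theorem iterate_mem_iff (hh : IsDenjoySemiconj f ρ h) (n : ℕ) {x : UnitAddCircle} :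
    f^[n] x ∈ h ⁻¹' injectiveOrbitValues ρ h ↔ x ∈ h ⁻¹' injectiveOrbitValues ρ h := by
  induction n with
  | zero => rfl
  | succ n ih => rw [iterate_succ_apply', hh.map_mem_iff, ih]

theorem image_eq (hh : IsDenjoySemiconj f ρ h) (hf : Surjective f) :
    f '' (h ⁻¹' injectiveOrbitValues ρ h) = h ⁻¹' injectiveOrbitValues ρ h := by
  have : f ⁻¹' (h ⁻¹' injectiveOrbitValues ρ h) = h ⁻¹' injectiveOrbitValues ρ h :=
    Set.ext fun _ => hh.map_mem_iff
  conv_lhs => rw [← this]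
  exact image_preimage_eq _ hf

/-- If `f` is constant on `V`, so is `h`, whose fibre through `x` is a singleton; but the circle has
no isolated points. -/
theorem disjoint_locallyConstantSet (hh : IsDenjoySemiconj f ρ h) :
    Disjoint (h ⁻¹' injectiveOrbitValues ρ h) (locallyConstantSet f) := by
  rw [Set.disjoint_left]
  rintro x hx ⟨V, hV, c, hc⟩
  have hsub : V ⊆ {x} := fun y hy => by
    refine eq_of_mem_injectiveOrbitValues hx ?_
    have : h (f y) = h (f x) := by rw [hc y hy, hc x (mem_of_mem_nhds hV)]
    simpa only [hh.apply_map, add_left_inj] using this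
  exact (infinite_of_mem_nhds x hV) ((finite_singleton x).subset hsub)

theorem exists_homeomorph (hh : IsDenjoySemiconj f ρ h) :
    ∃ φ : (h ⁻¹' injectiveOrbitValues ρ h) ≃ₜ (h '' (h ⁻¹' injectiveOrbitValues ρ h)),
      ∀ θ, (φ θ : UnitAddCircle) = h θ := by
  have himg : h '' (h ⁻¹' injectiveOrbitValues ρ h) = injectiveOrbitValues ρ h :=
    image_preimage_eq _ hh.surjective
  rw [himg]
  have hinj : Injective ((injectiveOrbitValues ρ h).restrictPreimage h) := fun x y hxy =>
    Subtype.ext (eq_of_mem_injectiveOrbitValues (ρ := ρ) y.2 (congrArg Subtype.val hxy))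
  have hsurj : Surjective ((injectiveOrbitValues ρ h).restrictPreimage h) :=
    restrictPreimage_surjective _ hh.surjective
  -- By compactness `h` is closed, and closedness survives restriction to a full preimage.
  exact ⟨(Equiv.ofBijective _ ⟨hinj, hsurj⟩).toHomeomorphOfContinuousClosed
    hh.continuous.restrictPreimage
    (hh.continuous.isClosedMap.restrictPreimage _), fun θ => rfl⟩

theorem dense_image (hh : IsDenjoySemiconj f ρ h) :
    Dense (h '' (h ⁻¹' injectiveOrbitValues ρ h)) := by
  rw [image_preimage_eq _ hh.surjective]
  exact Measure.dense_of_ae (μ := volume) (p := (· ∈ injectiveOrbitValues ρ h))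
    hh.volume_compl_injectiveOrbitValues

theorem circleRotation_image (hh : IsDenjoySemiconj f ρ h) (hf : Surjective f) :
    circleRotation ρ '' (h '' (h ⁻¹' injectiveOrbitValues ρ h)) =
      h '' (h ⁻¹' injectiveOrbitValues ρ h) := by
  rw [← hh.semiconj.set_image, hh.image_eq hf]

theorem isNowhereDense (hh : IsDenjoySemiconj f ρ h) (hρ : Irrational ρ) (hf : Continuous f)
    (hsurj : Surjective f) (hne : (locallyConstantSet f).Nonempty) :
    IsNowhereDense (h ⁻¹' injectiveOrbitValues ρ h) := by
  rw [IsNowhereDense, eq_empty_iff_forall_notMem]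
  intro x hx
  obtain ⟨p, hp⟩ := hne
  obtain ⟨u, huW, hu⟩ := mem_closure_iff.1 (interior_subset hx) _ isOpen_interior hx
  set W := interior (closure (h ⁻¹' injectiveOrbitValues ρ h))
  -- The open set of values whose entire fibre lies in `W`.
  have hN : IsOpen (h '' Wᶜ)ᶜ :=
    (hh.continuous.isClosedMap _ isOpen_interior.isClosed_compl).isOpen_compl
  have huN : h u ∈ (h '' Wᶜ)ᶜ := by
    rintro ⟨v, hv, hvu⟩
    exact hv (eq_of_mem_injectiveOrbitValues hu hvu ▸ huW)
  have hdense : DenseRange fun n : ℕ => h p - n • (ρ : UnitAddCircle) :=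
    (Homeomorph.subLeft (h p)).surjective.denseRange.comp (denseRange_nsmul_coe_of_irrational hρ)
      (Homeomorph.subLeft (h p)).continuous
  obtain ⟨n, hn⟩ := hdense.exists_mem_open hN ⟨_, huN⟩
  -- An `n`-th preimage of the point of `Con(f)` lies in `W`, so `U` meets the open set
  -- `f⁻ⁿ(Con(f))`, against its invariance.
  obtain ⟨w, rfl⟩ := hsurj.iterate n p
  rw [hh.apply_iterate, add_sub_cancel_right] at hn
  have hw : w ∈ closure (h ⁻¹' injectiveOrbitValues ρ h) := by
    apply interior_subset
    by_contra hw
    exact hn ⟨w, hw, rfl⟩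
  obtain ⟨v, hv, hvU⟩ := mem_closure_iff.1 hw _
    ((isOpen_locallyConstantSet f).preimage (hf.iterate n)) hp
  exact disjoint_left.1 hh.disjoint_locallyConstantSet ((hh.iterate_mem_iff n).2 hvU) hv

end IsDenjoySemiconj

/-! ### Unique ergodicity and the invariant measure -/

open scoped BoundedContinuousFunction

instance UnitAddCircle.instIsProbabilityMeasure :
    IsProbabilityMeasure (volume : Measure UnitAddCircle) :=
  ⟨UnitAddCircle.measure_univ⟩

/-- Irrational rotations of the circle are uniquely ergodic. -/
theorem eq_volume_of_measurePreserving_circleRotation {ρ : ℝ} (hρ : Irrational ρ)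
    {ν : Measure UnitAddCircle} [IsProbabilityMeasure ν]
    (hν : MeasurePreserving (circleRotation ρ) ν ν) : ν = volume := by
  -- Invariance under the dense multiples of `ρ` extends to all translations by continuity in `c`,
  -- so `ν` is Haar measure.
  have hinv (φ : UnitAddCircle →ᵇ ℝ) (c : UnitAddCircle) :
      ∫ x, φ (c + x) ∂ν = ∫ x, φ x ∂ν := by
    have hcont : Continuous fun c => ∫ x, φ (c + x) ∂ν := by
      refine continuous_of_dominated (bound := fun _ => ‖φ‖) (fun c => ?_) (fun c => ?_)
        (integrable_const _) ?_
      · exact (by fun_prop : Continuous fun x => φ (c + x)).aestronglyMeasurable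
      · exact Eventually.of_forall fun x => φ.norm_coe_le_norm _
      · exact Eventually.of_forall fun x => by fun_prop
    refine congrFun ((denseRange_nsmul_coe_of_irrational hρ).equalizer hcont continuous_const
      (funext fun n => ?_)) c
    change ∫ x, φ (n • (ρ : UnitAddCircle) + x) ∂ν = ∫ x, φ x ∂ν
    have hit := hν.iterate n
    have hform (x : UnitAddCircle) :
        (circleRotation ρ)^[n] x = n • (ρ : UnitAddCircle) + x := by
      induction n with
      | zero => simp
      | succ n ih =>
        rw [iterate_succ_apply', ih (hν.iterate n), circleRotation, succ_nsmul]
        abel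
    conv_rhs => rw [← hit.map_eq]
    rw [integral_map hit.measurable.aemeasurable φ.continuous.aestronglyMeasurable]
    simp only [hform]
  have hleft : ν.IsAddLeftInvariant := by
    refine ⟨fun c => ?_⟩
    have : IsProbabilityMeasure (ν.map (c + ·)) :=
      Measure.isProbabilityMeasure_map (by fun_prop)
    refine ext_of_forall_integral_eq_of_IsFiniteMeasure fun φ => ?_
    rw [integral_map (by fun_prop) φ.continuous.aestronglyMeasurable, hinv]
  have : ν.IsAddHaarMeasure :=
    Measure.isAddHaarMeasure_of_isCompact_nonempty_interior ν univ isCompact_univ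
      (by simp) (by simp) (by simp)
  exact Measure.isAddHaarMeasure_eq_of_isProbabilityMeasure ν volume

/-- A map with exactly one invariant probability measure is ergodic for it. -/
theorem Ergodic.of_unique_invariant {X : Type*} [MeasurableSpace X] {f : X → X} {μ : Measure X}
    [IsProbabilityMeasure μ] (hμ : MeasurePreserving f μ μ)
    (huniq : ∀ ν : Measure X, IsProbabilityMeasure ν → MeasurePreserving f ν ν → ν = μ) :
    Ergodic f μ :=
  .of_mem_extremePoints ⟨⟨hμ, inferInstance⟩, fun ν hν _ _ _ => huniq ν hν.2 hν.1⟩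

theorem image_restrict_preimage_val {α β : Type*} (h : α → β) (s u : Set α) :
    (fun x : u => h x) '' (Subtype.val ⁻¹' s) = h '' (s ∩ u) := by
  rw [inter_comm, ← Subtype.image_preimage_coe, image_image]

namespace IsDenjoySemiconj

variable {ρ : ℝ} {f h : UnitAddCircle → UnitAddCircle}

theorem measurableEmbedding (hh : IsDenjoySemiconj f ρ h) :
    MeasurableEmbedding fun x : h ⁻¹' injectiveOrbitValues ρ h => h x := by
  obtain ⟨φ, hφ⟩ := hh.exists_homeomorph
  have heq : (fun x : h ⁻¹' injectiveOrbitValues ρ h => h x) = Subtype.val ∘ φ :=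
    funext fun x => (hφ x).symm
  rw [heq]
  refine (MeasurableEmbedding.subtype_coe ?_).comp φ.measurableEmbedding
  rw [image_preimage_eq _ hh.surjective]
  exact hh.measurableSet_injectiveOrbitValues

/-- The transport of `ν` along the inverse of `h` on its injectivity set. -/
noncomputable def transport (ρ : ℝ) (h : UnitAddCircle → UnitAddCircle)
    (ν : Measure UnitAddCircle) : Measure UnitAddCircle :=
  (ν.comap fun x : h ⁻¹' injectiveOrbitValues ρ h => h x).map Subtype.val

theorem transport_apply (hh : IsDenjoySemiconj f ρ h) (ν : Measure UnitAddCircle)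
    {s : Set UnitAddCircle} (hs : MeasurableSet s) :
    transport ρ h ν s = ν (h '' (s ∩ h ⁻¹' injectiveOrbitValues ρ h)) := by
  rw [transport, Measure.map_apply measurable_subtype_coe hs, hh.measurableEmbedding.comap_apply]
  rw [image_restrict_preimage_val]

/-- Such a `ν` is carried by `U`, and every subset of `U` is the full `h`-preimage of its image. -/
theorem eq_transport_of_map_eq_volume (hh : IsDenjoySemiconj f ρ h) {ν : Measure UnitAddCircle}
    (hν : ν.map h = volume) : ν = transport ρ h volume := by
  have hnull : ν (h ⁻¹' injectiveOrbitValues ρ h)ᶜ = 0 := by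
    rw [← preimage_compl, ← Measure.map_apply hh.continuous.measurable
      hh.measurableSet_injectiveOrbitValues.compl, hν, hh.volume_compl_injectiveOrbitValues]
  ext s hs
  have hpre : h ⁻¹' (h '' (s ∩ h ⁻¹' injectiveOrbitValues ρ h)) =
      s ∩ h ⁻¹' injectiveOrbitValues ρ h := by
    refine (subset_preimage_image _ _).antisymm' ?_
    rintro x ⟨y, hy, hyx⟩
    rwa [eq_of_mem_injectiveOrbitValues hy.2 hyx.symm]
  have himg : MeasurableSet (h '' (s ∩ h ⁻¹' injectiveOrbitValues ρ h)) := by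
    have := hh.measurableEmbedding.measurableSet_image.2 (measurable_subtype_coe hs)
    rwa [image_restrict_preimage_val] at this
  rw [hh.transport_apply _ hs, ← hν, Measure.map_apply hh.continuous.measurable himg, hpre]
  exact (measure_inter_conull hnull).symm

theorem map_transport (hh : IsDenjoySemiconj f ρ h) :
    (transport ρ h volume).map h = volume := by
  rw [transport, Measure.map_map hh.continuous.measurable measurable_subtype_coe]
  change Measure.map (fun x : h ⁻¹' injectiveOrbitValues ρ h => h x) _ = _
  rw [hh.measurableEmbedding.map_comap]
  refine Measure.restrict_eq_self_of_ae_mem ?_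
  refine measure_mono_null (compl_subset_compl.2 ?_) hh.volume_compl_injectiveOrbitValues
  intro t ht
  obtain ⟨x, rfl⟩ := hh.surjective t
  exact ⟨⟨x, ht⟩, rfl⟩

theorem eq_transport_of_measurePreserving (hh : IsDenjoySemiconj f ρ h) (hρ : Irrational ρ)
    {ν : Measure UnitAddCircle} [IsProbabilityMeasure ν] (hν : MeasurePreserving f ν ν) :
    ν = transport ρ h volume := by
  have hm := hh.continuous.measurable
  have hrot : Measurable (circleRotation ρ) := measurable_id.add_const _
  have := Measure.isProbabilityMeasure_map (μ := ν) hm.aemeasurable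
  refine hh.eq_transport_of_map_eq_volume
    (eq_volume_of_measurePreserving_circleRotation hρ ⟨hrot, ?_⟩)
  rw [Measure.map_map hrot hm, ← hh.semiconj.comp_eq, ← Measure.map_map hm hν.measurable,
    hν.map_eq]

theorem measurePreserving_transport (hh : IsDenjoySemiconj f ρ h) (hf : Continuous f) :
    MeasurePreserving f (transport ρ h volume) (transport ρ h volume) := by
  have hm := hh.continuous.measurable
  have hrot : MeasurePreserving (circleRotation ρ) volume volume :=
    measurePreserving_add_right volume _
  -- Invariance follows from uniqueness: the push-forward by `f` also projects to Lebesgue measure.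
  refine ⟨hf.measurable, hh.eq_transport_of_map_eq_volume ?_⟩
  rw [Measure.map_map hm hf.measurable, hh.semiconj.comp_eq, ← Measure.map_map hrot.measurable hm,
    hh.map_transport, hrot.map_eq]

theorem isProbabilityMeasure_transport (hh : IsDenjoySemiconj f ρ h) :
    IsProbabilityMeasure (transport ρ h volume) := by
  refine ⟨?_⟩
  rw [← preimage_univ (f := h), ← Measure.map_apply hh.continuous.measurable .univ,
    hh.map_transport, measure_univ]

theorem transport_preimage_eq_one (hh : IsDenjoySemiconj f ρ h) :
    transport ρ h volume (h ⁻¹' injectiveOrbitValues ρ h) = 1 := by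
  rw [← Measure.map_apply hh.continuous.measurable hh.measurableSet_injectiveOrbitValues,
    hh.map_transport, prob_compl_eq_zero_iff hh.measurableSet_injectiveOrbitValues |>.1
      hh.volume_compl_injectiveOrbitValues]

end IsDenjoySemiconj


theorem proposition2p1 (f : UnitAddCircle → UnitAddCircle) (hf : Continuous f)
    (F : CircleDeg1Lift) (hFc : Continuous F) (hF : IsCircleLift F f)
    (hρ : Irrational F.translationNumber) :
    (∃ h : UnitAddCircle → UnitAddCircle, IsDenjoySemiconj f F.translationNumber h) ∧
    ∃ (U : Set UnitAddCircle) (μ : MeasureTheory.Measure UnitAddCircle),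
      MeasurableSet U ∧ f '' U = U ∧
      MeasureTheory.IsProbabilityMeasure μ ∧ Ergodic f μ ∧
      (∀ ν : MeasureTheory.Measure UnitAddCircle,
        MeasureTheory.IsProbabilityMeasure ν → Ergodic f ν → ν = μ) ∧
      μ U = 1 ∧
      Disjoint (closure U) (locallyConstantSet f) ∧
      (∀ h : UnitAddCircle → UnitAddCircle, IsDenjoySemiconj f F.translationNumber h →
        (∃ φ : U ≃ₜ (h '' U), ∀ θ : U, (φ θ : UnitAddCircle) = h θ) ∧
        Dense (h '' U) ∧
        circleRotation F.translationNumber '' (h '' U) = h '' U) ∧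
      (¬ IsHomeomorph f → IsNowhereDense U) := by
  have hsurj : Surjective f := hF.surjective hFc
  obtain ⟨h, hh⟩ := exists_isDenjoySemiconj hF hρ
  set ρ := F.translationNumber
  have hprob := hh.isProbabilityMeasure_transport
  refine ⟨⟨h, hh⟩, h ⁻¹' injectiveOrbitValues ρ h, IsDenjoySemiconj.transport ρ h volume,
    hh.measurableSet_preimage, hh.image_eq hsurj, hprob, ?_, ?_, hh.transport_preimage_eq_one,
    ?_, ?_, ?_⟩
  · exact .of_unique_invariant (hh.measurePreserving_transport hf)
      fun ν _ hν => hh.eq_transport_of_measurePreserving hρ hν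
  · exact fun ν _ hν => hh.eq_transport_of_measurePreserving hρ hν.toMeasurePreserving
  · exact hh.disjoint_locallyConstantSet.closure_left (isOpen_locallyConstantSet f)
  · intro h' hh'
    obtain ⟨c, hc⟩ := hh.exists_eq_add hF hFc hρ hh'
    rw [← preimage_injectiveOrbitValues_congr hc]
    exact ⟨hh'.exists_homeomorph, hh'.dense_image, hh'.circleRotation_image hsurj⟩
  · intro hnot
    refine hh.isNowhereDense hρ hf hsurj (hF.nonempty_locallyConstantSet fun hinj => hnot ?_)
    exact isHomeomorph_iff_continuous_bijective.2 ⟨hf, hinj, hsurj⟩
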